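/- Let $\lambda\in\mathbb R$, $\eta\ge 0$, and let $(P_n)_{n\ge0}$ be the monic polynomials of the (centered, classical) Meixner class, given by $P_0=1$, $P_{-1}=0$ and $$xP_n(x)=P_{n+1}(x)+\lambda nP_n(x)+n(1+\eta(n-1))P_{n-1}(x),\qquad n\ge0.$$ Let $\mathcal E^1_{\min}(\mathbb R)$ be the space of restrictions to $\mathbb R$ of the entire functions $f$ of first order and minimal type (for every $\varepsilon>0$ there is $C>0$ with $|f(z)|\le Ce^{\varepsilon|z|}$ on $\mathbb C$), with the topology given by the norms $\big(\sum_n|f_n|^2(n!)^22^{nq}\big)^{1/2}$, $q\in\mathbb N$, for $f(z)=\sum_n f_nz^n$. For $f\in\mathcal E^1_{\min}(\mathbb R)$ and $s\in\mathbb C$ put $(U_sf)(x)=f(x+s)$ and, if $s\ne0$, $(\nabla_sf)(x)=\frac{f(x+s)-f(x)}{s}$ (using the entire extension of $f$ when $s$ is not real); let $D$ be differentiation and $x$ multiplication by the variable. There is exactly one continuous linear operator $\partial^\dagger_{\lambda,\eta}$ on $\mathcal E^1_{\min}(\mathbb R)$ with $\partial^\dagger_{\lambda,\eta}P_n=P_{n+1}$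 for all $n\ge0$ (the raising operator), and on $\mathcal E^1_{\min}(\mathbb R)$ it is given as follows. - If $\lambda=\eta=0$: $\ \partial^\dagger_{0,0}=x-D$. - If $\lambda\ne0$ and $\eta=0$: $\ \partial^\dagger_{\lambda,0}=x(1-\lambda\nabla_{-\lambda})-\nabla_{-\lambda}$. - If $\eta>0$ and $\lambda^2=4\eta$: $\ \partial^\dagger_{\lambda,\eta}=x\big(1-\tfrac{\lambda}{2}D\big)^2-D\big(1-\tfrac{\lambda}{2}D\big)$. - If $\eta>0$ and $\lambda^2\ne4\eta$: for $\alpha,\beta\in\mathbb C$ with $\alpha+\beta=-\lambda$, $\alpha\beta=\eta$, $$\partial^\dagger_{\lambda,\eta}=x(1+\alpha\nabla_{\alpha-\beta})^2U_{\beta-\alpha}-(1+\alpha\nabla_{\alpha-\beta})\nabla_{\alpha-\beta}U_{\beta-\alpha}.$$ -/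

import Mathlib

namespace ClassicalMeixner

noncomputable section

/-! ### Entire functions of first order of growth and minimal type -/

/-- The space of entire functions `f` such that for every `ε > 0` there is `C > 0` with
`|f z| ≤ C exp (ε |z|)`. -/
def EminC : Submodule ℂ (ℂ → ℂ) where
  carrier := {f | Differentiable ℂ f ∧
    ∀ ε : ℝ, 0 < ε → ∃ C : ℝ, 0 < C ∧ ∀ z : ℂ, ‖f z‖ ≤ C * Real.exp (ε * ‖z‖)}
  add_mem' := by
    rintro f g ⟨hf, hf'⟩ ⟨hg, hg'⟩
    refine ⟨hf.add hg, fun ε hε => ?_⟩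
    obtain ⟨C, hC, h⟩ := hf' ε hε
    obtain ⟨C', hC', h'⟩ := hg' ε hε
    refine ⟨C + C', by positivity, fun z => ?_⟩
    calc ‖(f + g) z‖ ≤ ‖f z‖ + ‖g z‖ := norm_add_le _ _
      _ ≤ _ := by rw [add_mul]; exact add_le_add (h z) (h' z)
  zero_mem' := ⟨differentiable_const _, fun ε _ => ⟨1, one_pos, fun z => by
    simp only [Pi.zero_apply, norm_zero]; positivity⟩⟩
  smul_mem' := by
    rintro c f ⟨hf, hf'⟩
    refine ⟨hf.const_smul c, fun ε hε => ?_⟩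
    obtain ⟨C, hC, h⟩ := hf' ε hε
    refine ⟨(‖c‖ + 1) * C, by positivity, fun z => ?_⟩
    have h1 : ‖(c • f) z‖ = ‖c‖ * ‖f z‖ := by simp
    rw [h1, mul_assoc]
    have h2 : 0 ≤ ‖f z‖ := norm_nonneg _
    have h3 := h z
    have h4 : 0 ≤ ‖c‖ := norm_nonneg _
    calc ‖c‖ * ‖f z‖ ≤ (‖c‖ + 1) * ‖f z‖ := by nlinarith
      _ ≤ _ := by gcongr

/-- The `n`-th Taylor coefficient at `0`. -/
def taylorCoeff (f : ℂ → ℂ) (n : ℕ) : ℂ := iteratedDeriv n f 0 / (n.factorial : ℂ)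

/-- `N_q(f) = ∑ |f_n|² (n!)² 2^{nq}` for `f(z) = ∑ f_n z^n`. -/
def sqNorm (q : ℕ) (f : ℂ → ℂ) : ℝ :=
  ∑' n : ℕ, ‖taylorCoeff f n‖ ^ 2 * (n.factorial : ℝ) ^ 2 * 2 ^ (n * q)

theorem norm_taylorCoeff_mul_factorial (f : ℂ → ℂ) (n : ℕ) :
    ‖taylorCoeff f n‖ * (n.factorial : ℝ) = ‖iteratedDeriv n f 0‖ := by
  have : (n.factorial : ℝ) ≠ 0 := by exact_mod_cast n.factorial_ne_zero
  rw [taylorCoeff, norm_div, Complex.norm_natCast]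
  field_simp

theorem exists_norm_iteratedDeriv_le (f : EminC) {δ : ℝ} (hδ : 0 < δ) :
    ∃ C : ℝ, 0 < C ∧ ∀ n : ℕ, ‖iteratedDeriv n f.1 0‖ ≤ C * δ ^ n := by
  obtain ⟨f, hf, hf'⟩ := f
  have he : (0 : ℝ) < Real.exp 1 := Real.exp_pos 1
  set ε : ℝ := δ / Real.exp 1 with hεd
  have hε : 0 < ε := by positivity
  obtain ⟨C, hC, h⟩ := hf' ε hε
  refine ⟨C, hC, fun n => ?_⟩
  rcases Nat.eq_zero_or_pos n with rfl | hn
  · simpa using h 0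
  · have hn' : (0 : ℝ) < n := by exact_mod_cast hn
    have hR : 0 < (n : ℝ) / ε := by positivity
    have key := Complex.norm_iteratedDeriv_le_of_forall_mem_sphere_norm_le (c := 0)
      (C := C * Real.exp n) n hR hf.diffContOnCl (fun z hz => by
        have hz' : ‖z‖ = n / ε := by simpa using hz
        have := h z
        rw [hz'] at this
        have h2 : ε * (n / ε) = n := by field_simp
        rwa [h2] at this)
    refine key.trans ?_
    have hfac : (n.factorial : ℝ) ≤ (n : ℝ) ^ n := by exact_mod_cast n.factorial_le_pow
    have hexp : Real.exp n = Real.exp 1 ^ n := by rw [← Real.exp_nat_mul, mul_one]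
    have hδe : δ = ε * Real.exp 1 := by rw [hεd]; field_simp
    rw [hexp, div_pow, hδe, mul_pow, div_div_eq_mul_div, div_le_iff₀ (by positivity)]
    calc (n.factorial : ℝ) * (C * Real.exp 1 ^ n) * ε ^ n
        ≤ (n : ℝ) ^ n * (C * Real.exp 1 ^ n) * ε ^ n := by gcongr
      _ = _ := by ring

theorem summable_sqNorm (q : ℕ) (f : EminC) :
    Summable fun n : ℕ => ‖taylorCoeff f.1 n‖ ^ 2 * (n.factorial : ℝ) ^ 2 * 2 ^ (n * q) := by
  obtain ⟨C, hC, h⟩ := exists_norm_iteratedDeriv_le f (δ := (1 / 2) ^ (q + 1)) (by positivity)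
  have hg : Summable fun n : ℕ => C ^ 2 * (1 / 2 : ℝ) ^ n :=
    (summable_geometric_of_lt_one (by norm_num) (by norm_num)).mul_left _
  refine Summable.of_nonneg_of_le (fun n => by positivity) (fun n => ?_) hg
  rw [← mul_pow, norm_taylorCoeff_mul_factorial]
  calc ‖iteratedDeriv n f.1 0‖ ^ 2 * 2 ^ (n * q)
      ≤ (C * ((1 / 2) ^ (q + 1)) ^ n) ^ 2 * 2 ^ (n * q) := by gcongr; exact h n
    _ = C ^ 2 * ((1 / 2 : ℝ) ^ (n * (q + 2)) * ((1 / 2) ^ (n * q) * 2 ^ (n * q))) := by ring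
    _ = C ^ 2 * (1 / 2 : ℝ) ^ (n * (q + 2)) := by
        rw [← mul_pow]; norm_num
    _ ≤ C ^ 2 * (1 / 2 : ℝ) ^ n := by
        gcongr C ^ 2 * ?_
        exact pow_le_pow_of_le_one (by norm_num) (by norm_num) (by nlinarith [Nat.zero_le (n * q)])

theorem taylorCoeff_add (f g : EminC) (n : ℕ) :
    taylorCoeff (f + g).1 n = taylorCoeff f.1 n + taylorCoeff g.1 n := by
  have hf : ContDiffAt ℂ n f.1 0 := f.2.1.contDiff.contDiffAt
  have hg : ContDiffAt ℂ n g.1 0 := g.2.1.contDiff.contDiffAt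
  simp only [taylorCoeff, Submodule.coe_add]
  rw [iteratedDeriv_add hf hg, add_div]

theorem taylorCoeff_smul (c : ℂ) (f : EminC) (n : ℕ) :
    taylorCoeff (c • f).1 n = c * taylorCoeff f.1 n := by
  have hf : ContDiffAt ℂ n f.1 0 := f.2.1.contDiff.contDiffAt
  simp only [taylorCoeff, Submodule.coe_smul]
  rw [iteratedDeriv_const_smul hf, smul_eq_mul, mul_div_assoc]

theorem sqrt_sqNorm_add_le (q : ℕ) (f g : EminC) :
    √(sqNorm q (f + g).1) ≤ √(sqNorm q f.1) + √(sqNorm q g.1) := by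
  have key : ∀ h : EminC, ∀ n : ℕ,
      ‖taylorCoeff h.1 n‖ ^ 2 * (n.factorial : ℝ) ^ 2 * 2 ^ (n * q) =
        (‖taylorCoeff h.1 n‖ * n.factorial * √(2 ^ (n * q))) ^ (2 : ℝ) := by
    intro h n
    rw [Real.rpow_two, mul_pow, mul_pow, Real.sq_sqrt (by positivity)]
  have hs : ∀ h : EminC, Summable fun n : ℕ =>
      (‖taylorCoeff h.1 n‖ * n.factorial * √(2 ^ (n * q))) ^ (2 : ℝ) := by
    intro h
    simpa only [key h] using summable_sqNorm q h
  have hN : ∀ h : EminC, √(sqNorm q h.1) = (∑' n : ℕ,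
      (‖taylorCoeff h.1 n‖ * n.factorial * √(2 ^ (n * q))) ^ (2 : ℝ)) ^ (1 / (2 : ℝ)) := by
    intro h
    rw [Real.sqrt_eq_rpow, sqNorm]
    simp only [key h]
  have hM := Real.Lp_add_le_tsum_of_nonneg (p := 2) (by norm_num)
    (fun n => by positivity) (fun n => by positivity) (hs f) (hs g)
  rw [hN, hN, hN]
  refine le_trans (Real.rpow_le_rpow (tsum_nonneg fun n => by positivity) ?_ (by norm_num)) hM.2
  refine (hs (f + g)).tsum_le_tsum (fun n => ?_) hM.1
  refine Real.rpow_le_rpow (by positivity) ?_ (by norm_num)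
  rw [taylorCoeff_add, ← add_mul, ← add_mul]
  gcongr
  exact norm_add_le _ _

/-- The norm `√(N_q(f))`. -/
def seminormC (q : ℕ) : Seminorm ℂ EminC :=
  Seminorm.of (fun f => √(sqNorm q f.1)) (sqrt_sqNorm_add_le q) (by
    intro c f
    have : sqNorm q (c • f).1 = ‖c‖ ^ 2 * sqNorm q f.1 := by
      rw [sqNorm, sqNorm, ← tsum_mul_left]
      refine tsum_congr fun n => ?_
      rw [taylorCoeff_smul, norm_mul]
      ring
    rw [this, Real.sqrt_mul (by positivity), Real.sqrt_sq (norm_nonneg _)])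

/-! ### Restrictions to the real line -/

/-- Restriction of a function to the real line. -/
def restrict : EminC →ₗ[ℂ] (ℝ → ℂ) where
  toFun f := fun x => f.1 x
  map_add' _ _ := rfl
  map_smul' _ _ := rfl

theorem restrict_injective : Function.Injective restrict := by
  intro f g h
  apply Subtype.ext
  have hf : AnalyticOnNhd ℂ f.1 Set.univ := f.2.1.differentiableOn.analyticOnNhd isOpen_univ
  have hg : AnalyticOnNhd ℂ g.1 Set.univ := g.2.1.differentiableOn.analyticOnNhd isOpen_univ
  refine hf.eq_of_frequently_eq (z₀ := 0) hg ?_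
  have ht : Filter.Tendsto (fun x : ℝ => (x : ℂ)) (nhdsWithin 0 {0}ᶜ) (nhdsWithin 0 {0}ᶜ) := by
    refine tendsto_nhdsWithin_of_tendsto_nhds_of_eventually_within _ ?_ ?_
    · exact (Complex.continuous_ofReal.tendsto' 0 0 (by simp)).mono_left nhdsWithin_le_nhds
    · filter_upwards [self_mem_nhdsWithin] with x hx
      simpa using hx
  refine ht.frequently (Filter.Eventually.frequently (Filter.Eventually.of_forall fun x => ?_))
  exact congrFun h x

/-- The space of restrictions to `ℝ` of entire functions of first order and minimal type.
(A separate type, because it does not carry the topology of pointwise convergence.) -/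
def EminR : Type := LinearMap.range restrict

instance : AddCommGroup EminR := inferInstanceAs (AddCommGroup (LinearMap.range restrict))

instance : Module ℂ EminR := inferInstanceAs (Module ℂ (LinearMap.range restrict))

instance : CoeFun EminR (fun _ => ℝ → ℂ) := ⟨fun f => Subtype.val f⟩

/-- Restriction to `ℝ` as a linear isomorphism. -/
def toReal : EminC ≃ₗ[ℂ] EminR := LinearEquiv.ofInjective restrict restrict_injective

theorem toReal_apply (f : EminC) (x : ℝ) : toReal f x = f.1 x := rfl

theorem symm_apply_ofReal (f : EminR) (x : ℝ) : (toReal.symm f).1 (x : ℂ) = f x := by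
  rw [← toReal_apply, LinearEquiv.apply_symm_apply]

/-- The norm `√(N_q)` of the entire extension. -/
def seminormR : SeminormFamily ℂ EminR ℕ :=
  fun q => (seminormC q).comp toReal.symm.toLinearMap

theorem seminormR_apply (q : ℕ) (f : EminR) :
    seminormR q f = √(∑' n : ℕ, ‖taylorCoeff (toReal.symm f).1 n‖ ^ 2 *
      (n.factorial : ℝ) ^ 2 * 2 ^ (n * q)) := rfl

/-- The topology determined by all the norms `√(N_q)`. -/
instance : TopologicalSpace EminR := seminormR.moduleFilterBasis.topology

theorem withSeminorms : WithSeminorms seminormR := ⟨rfl⟩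

/-! ### Operators -/

/-- Multiplication by the variable, on entire functions. -/
def mulC : Module.End ℂ EminC where
  toFun f := ⟨fun z => z * f.1 z, differentiable_id.mul f.2.1, fun ε hε => by
    obtain ⟨C, hC, h⟩ := f.2.2 (ε / 2) (by positivity)
    refine ⟨(2 / ε) * C, by positivity, fun z => ?_⟩
    have h1 : ε / 2 * ‖z‖ ≤ Real.exp (ε / 2 * ‖z‖) := by
      linarith [Real.add_one_le_exp (ε / 2 * ‖z‖)]
    have h2 : ‖z‖ ≤ 2 / ε * Real.exp (ε / 2 * ‖z‖) := by
      calc ‖z‖ = 2 / ε * (ε / 2 * ‖z‖) := by field_simp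
        _ ≤ _ := by gcongr
    have h3 : Real.exp (ε * ‖z‖) = Real.exp (ε / 2 * ‖z‖) * Real.exp (ε / 2 * ‖z‖) := by
      rw [← Real.exp_add]; ring_nf
    rw [norm_mul, h3]
    calc ‖z‖ * ‖f.1 z‖ ≤ (2 / ε * Real.exp (ε / 2 * ‖z‖)) * (C * Real.exp (ε / 2 * ‖z‖)) := by
          gcongr
          exact h z
      _ = _ := by ring⟩
  map_add' f g := Subtype.ext (funext fun z => mul_add z (f.1 z) (g.1 z))
  map_smul' c f := Subtype.ext (funext fun z => mul_left_comm z c (f.1 z))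

/-- The shift `f ↦ f(· + s)`, on entire functions. -/
def shiftC (s : ℂ) : Module.End ℂ EminC where
  toFun f := ⟨fun z => f.1 (z + s), f.2.1.comp (differentiable_id.add_const s), fun ε hε => by
    obtain ⟨C, hC, h⟩ := f.2.2 ε hε
    refine ⟨C * Real.exp (ε * ‖s‖), by positivity, fun z => ?_⟩
    refine (h (z + s)).trans ?_
    rw [mul_assoc, ← Real.exp_add, ← mul_add, add_comm ‖s‖]
    gcongr
    exact norm_add_le _ _⟩
  map_add' _ _ := rfl
  map_smul' _ _ := rfl

/-- Differentiation, on entire functions. -/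
def derivC : Module.End ℂ EminC where
  toFun f := ⟨deriv f.1, f.2.1.deriv, fun ε hε => by
    obtain ⟨C, hC, h⟩ := f.2.2 ε hε
    refine ⟨C * Real.exp ε, by positivity, fun z => ?_⟩
    have := Complex.norm_deriv_le_of_forall_mem_sphere_norm_le (c := z) (R := 1)
      (C := C * Real.exp ε * Real.exp (ε * ‖z‖)) one_pos f.2.1.diffContOnCl (fun w hw => by
        refine (h w).trans ?_
        rw [mul_assoc, ← Real.exp_add]
        have hw' : ‖w‖ ≤ 1 + ‖z‖ := by
          have h1 : ‖w - z‖ = 1 := by simpa [dist_eq_norm] using hw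
          calc ‖w‖ = ‖(w - z) + z‖ := by ring_nf
            _ ≤ ‖w - z‖ + ‖z‖ := norm_add_le _ _
            _ = _ := by rw [h1]
        have h2 : ε * ‖w‖ ≤ ε + ε * ‖z‖ := by nlinarith
        gcongr)
    simpa using this⟩
  map_add' f g := Subtype.ext (funext fun z =>
    deriv_add f.2.1.differentiableAt g.2.1.differentiableAt)
  map_smul' c f := Subtype.ext (funext fun z =>
    deriv_const_smul c f.2.1.differentiableAt)

/-- The operator of multiplication by the variable `x`. -/
def mulX : Module.End ℂ EminR := toReal.conj mulC

/-- The operator `D` of differentiation. -/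
def D : Module.End ℂ EminR := toReal.conj derivC

/-- The shift `(U_s f)(x) = f(x + s)`; for non-real `s` the right-hand side is a value of the
entire extension of `f`. -/
def U (s : ℂ) : Module.End ℂ EminR := toReal.conj (shiftC s)

/-- The difference operator `(∇_s f)(x) = (f(x + s) - f(x)) / s`, for `s ≠ 0`. -/
def nabla (s : ℂ) : Module.End ℂ EminR := s⁻¹ • (U s - 1)

theorem mulX_apply (f : EminR) (x : ℝ) : mulX f x = x * f x := by
  rw [← symm_apply_ofReal f]; rfl

theorem U_apply (s : ℂ) (f : EminR) (x : ℝ) : U s f x = (toReal.symm f).1 (x + s) := rfl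

theorem U_apply_ofReal (s : ℝ) (f : EminR) (x : ℝ) : U s f x = f (x + s) := by
  rw [U_apply, ← Complex.ofReal_add, symm_apply_ofReal]

theorem nabla_apply (s : ℂ) (f : EminR) (x : ℝ) :
    nabla s f x = ((toReal.symm f).1 (x + s) - f x) / s := by
  rw [div_eq_inv_mul]; rfl

theorem nabla_apply_ofReal (s : ℝ) (f : EminR) (x : ℝ) :
    nabla s f x = (f (x + s) - f x) / s := by
  rw [nabla_apply, ← Complex.ofReal_add, symm_apply_ofReal]

theorem D_apply (f : EminR) (x : ℝ) : D f x = deriv (fun y : ℝ => f y) x := by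
  have h : HasDerivAt (toReal.symm f).1 (deriv (toReal.symm f).1 (x : ℂ)) (x : ℂ) :=
    ((toReal.symm f).2.1 (x : ℂ)).hasDerivAt
  have h2 := h.comp_ofReal
  simp only [symm_apply_ofReal] at h2
  rw [h2.deriv]; rfl

/-! ### Polynomials -/

theorem one_mem_EminC : (fun _ => 1 : ℂ → ℂ) ∈ EminC :=
  ⟨differentiable_const _, fun ε hε => ⟨1, one_pos, fun z => by
    have : 0 ≤ ε * ‖z‖ := by positivity
    simpa using this⟩⟩

theorem eval_mem_EminC (p : Polynomial ℂ) : (fun z => p.eval z) ∈ EminC := by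
  induction p using Polynomial.induction_on' with
  | add p q hp hq =>
    have := EminC.add_mem hp hq
    simp only [Polynomial.eval_add]
    exact this
  | monomial n a =>
    have h : ∀ n : ℕ, (fun z : ℂ => z ^ n) ∈ EminC := by
      intro n
      induction n with
      | zero => simpa only [pow_zero] using one_mem_EminC
      | succ n ih =>
        have := (mulC ⟨_, ih⟩).2
        simp only [pow_succ']
        exact this
    have := EminC.smul_mem a (h n)
    simp only [Polynomial.eval_monomial]
    exact this

/-- A real polynomial as an element of `EminR`. -/
def ofPoly (p : Polynomial ℝ) : EminR :=
  toReal ⟨fun z => (p.map (algebraMap ℝ ℂ)).eval z, eval_mem_EminC _⟩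

theorem ofPoly_apply (p : Polynomial ℝ) (x : ℝ) : ofPoly p x = ((p.eval x : ℝ) : ℂ) := by
  rw [ofPoly, toReal_apply]
  exact Polynomial.eval_map_algebraMap p (x : ℂ) |>.trans (Polynomial.aeval_ofReal p x)

open Polynomial in
/-- The monic polynomials of the (centered, `t = 1`) Meixner class: `P_0 = 1`, `P_{-1} = 0`,
`x P_n = P_{n+1} + λ n P_n + n (1 + η (n - 1)) P_{n-1}`. -/
def meixner (lam eta : ℝ) : ℕ → Polynomial ℝ
  | 0 => 1
  | 1 => X
  | n + 2 => (X - C (lam * (n + 1))) * meixner lam eta (n + 1)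
      - C ((n + 1) * (1 + eta * n)) * meixner lam eta n

/-- `T` is the raising operator on `EminR`: the continuous linear operator with
`T P_n = P_{n+1}` for all `n`. -/
def IsRaisingOperator (lam eta : ℝ) (T : EminR →L[ℂ] EminR) : Prop :=
  ∀ n : ℕ, T (ofPoly (meixner lam eta n)) = ofPoly (meixner lam eta (n + 1))

end

end ClassicalMeixner

/-! All four formulas are instances of `raising`, R = x(1+αN)²w − (1+αN)Nw. Here α, β are the roots
of t² + λt + η, N is ∇_{α−β} (or D if α = β), and w inverts the shift u = 1 + (α−β)N.

The Leibniz rule Nx = xN + u gives [N, R] = (1+αN)². Hence p_n = Rⁿ1 satisfies N p_n =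
n(1+αN)p_{n−1} (`lowering_orbit`). Formally, with ∂p_n = n p_{n−1}, this says N = ∂/(1−α∂), and then
w(1+αN)² is the inverse of (1−α∂)(1−β∂). Therefore R(1−α∂)(1−β∂)p_n = x p_n − ∂p_n. Expanding the
left side gives the Meixner recurrence (`mulX_orbit`), so p_n = P_n (`orbit_eq_ofPoly_meixner`).

On the topological side, x, D and the shifts are bounded from one norm to another, so R is
continuous. The Meixner polynomials span a dense subspace (`dense_span_meixner`), so in this
Hausdorff space no other continuous operator raises them. -/

namespace ClassicalMeixner

noncomputable section

/-! ### An abstract raising operator -/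

/-- The value at `n` of `n ↦ f (n - 1)`, extended by `0`. -/
def prev {V : Type*} [Zero V] (f : ℕ → V) : ℕ → V
  | 0 => 0
  | n + 1 => f n

theorem prev_succ {V : Type*} [Zero V] (f : ℕ → V) (n : ℕ) : prev f (n + 1) = f n := rfl

section Abstract

variable {V : Type*} [AddCommGroup V] [Module ℂ V]

/-- `(N, u, w, x)` is a difference calculus of step `s`: `u = 1 + s N` is a shift with
inverse `w`, and `N` satisfies the Leibniz rule `N x = x N + u`. -/
structure IsDifferenceCalculus (s : ℂ) (N u w x : Module.End ℂ V) : Prop where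
  shift_eq : u = 1 + s • N
  comm : w * N = N * w
  inv_mul : w * u = 1
  leibniz : N * x = x * N + u

/-- The operator `x (1 + α N)² w - (1 + α N) N w`. -/
def raising (α : ℂ) (N w x : Module.End ℂ V) : Module.End ℂ V :=
  x * (1 + α • N) ^ 2 * w - (1 + α • N) * N * w

variable {α β : ℂ} {N u w x : Module.End ℂ V}

/-- N, u, w and B = 1 + αN all commute, so only moving N past x contributes: it leaves uB²w = B². -/
theorem IsDifferenceCalculus.lowering_mul_raising (h : IsDifferenceCalculus (α - β) N u w x) :
    N * raising α N w x = raising α N w x * N + (1 + α • N) ^ 2 := by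
  have hc : Commute w (1 + α • N) :=
    (Commute.one_right w).add_right (Commute.smul_right h.comm α)
  have hN : Commute N (1 + α • N) :=
    (Commute.one_right N).add_right (Commute.smul_right (Commute.refl N) α)
  have hu : Commute u (1 + α • N) := by
    rw [h.shift_eq]
    exact (Commute.one_left _).add_left (hN.smul_left _)
  have hwu : u * w = 1 := by
    rw [← h.inv_mul, h.shift_eq, mul_add, add_mul, mul_one, one_mul, smul_mul_assoc,
      mul_smul_comm, h.comm]
  have hwN : Commute w N := h.comm
  unfold raising
  generalize 1 + α • N = B at *
  have e1 : N * (x * B ^ 2 * w) = x * B ^ 2 * w * N + B ^ 2 := by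
    calc N * (x * B ^ 2 * w) = (N * x) * (B ^ 2 * w) := by simp only [mul_assoc]
      _ = x * (N * (B ^ 2 * w)) + u * B ^ 2 * w := by rw [h.leibniz, add_mul]; simp only [mul_assoc]
      _ = x * (B ^ 2 * w * N) + B ^ 2 * (u * w) := by
          rw [((hN.pow_right 2).mul_right hwN.symm).eq, (hu.pow_right 2).eq]; simp only [mul_assoc]
      _ = _ := by rw [hwu, mul_one]; simp only [mul_assoc]
  have e2 : N * (B * N * w) = B * N * w * N :=
    ((hN.mul_right (Commute.refl N)).mul_right hwN.symm).eq
  rw [mul_sub, sub_mul, e1, e2]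
  abel

/-- The orbit of a vacuum vector under the raising operator. -/
def orbit (α : ℂ) (N w x : Module.End ℂ V) (e : V) (n : ℕ) : V := (raising α N w x ^ n) e

theorem orbit_succ (e : V) (n : ℕ) :
    orbit α N w x e (n + 1) = raising α N w x (orbit α N w x e n) := by
  rw [orbit, pow_succ']; rfl

/-- The factor n hides the default value 0 of `prev` at 0, where raising would fail to return the
vacuum. -/
theorem natCast_smul_raising_prev (e : V) (n : ℕ) :
    (n : ℂ) • raising α N w x (prev (orbit α N w x e) n) = (n : ℂ) • orbit α N w x e n := by
  cases n with
  | zero => simp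
  | succ n => rw [orbit_succ]; rfl

theorem lowering_orbit (h : IsDifferenceCalculus (α - β) N u w x) {e : V} (he : N e = 0) (n : ℕ) :
    N (orbit α N w x e n) = (n : ℂ) • (1 + α • N) (prev (orbit α N w x e) n) := by
  have key : ∀ v, N (raising α N w x v) =
      raising α N w x (N v) + (1 + α • N) ((1 + α • N) v) := fun v => by
    have := congrArg (fun f : Module.End ℂ V => f v) h.lowering_mul_raising
    simpa [pow_two] using this
  have hT := natCast_smul_raising_prev (α := α) (N := N) (w := w) (x := x) e
  induction n with
  | zero => simp [orbit, he]
  | succ n ih =>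
    have hB : ∀ v, (1 + α • N) v = v + α • N v := fun v => by simp
    -- With R the raising operator and B = 1 + αN, this is [B, R] = α[N, R] = αB².
    have hTB : ∀ v, raising α N w x ((1 + α • N) v) =
        (1 + α • N) (raising α N w x v) - α • (1 + α • N) ((1 + α • N) v) := fun v => by
      rw [hB (raising α N w x v), key, hB v, map_add, map_smul, smul_add]
      abel
    rw [orbit_succ, key, ih, map_smul, hTB, smul_sub, ← map_smul, hT n, smul_comm, ← map_smul,
      ← ih, hB (orbit α N w x e n), prev, map_add, map_smul, map_smul]
    push_cast
    module

/-! ### The three-term recurrence along the orbit -/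

/-- The combination of orbit vectors that `u⁻¹ (1 + α N)²` maps to `orbit n`. -/
def orbitPreimage (α β : ℂ) (f : ℕ → V) (n : ℕ) : V :=
  f n - ((α + β) * n) • prev f n + (α * β * (n * (n - 1))) • prev (prev f) n

/-- The coefficients n and n(n−1) vanish exactly where `prev` takes its default value, so raising
shifts every index by one. -/
theorem raising_orbitPreimage (e : V) (n : ℕ) :
    raising α N w x (orbitPreimage α β (orbit α N w x e) n) = orbit α N w x e (n + 1)
      - ((α + β) * n) • orbit α N w x e n
      + (α * β * (n * (n - 1))) • prev (orbit α N w x e) n := by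
  rw [orbit_succ]
  rcases n with _ | _ | n
  · simp [orbitPreimage]
  · simp [orbitPreimage, prev, orbit_succ]
  · simp [orbitPreimage, prev, orbit_succ]

theorem lowering_prev_orbit (h : IsDifferenceCalculus (α - β) N u w x) {e : V} (he : N e = 0)
    (n : ℕ) : N (prev (orbit α N w x e) n) =
      ((n : ℂ) - 1) • (1 + α • N) (prev (prev (orbit α N w x e)) n) := by
  cases n with
  | zero => simp [prev]
  | succ n => simpa [prev] using lowering_orbit h he n

/-- The preimage is (1−α∂)(1−β∂)p_n with ∂p_n = n p_{n−1}. A polynomial in ∂ with constant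
coefficients preserves the lowering relation. -/
theorem lowering_orbitPreimage (h : IsDifferenceCalculus (α - β) N u w x) {e : V} (he : N e = 0)
    (n : ℕ) : N (orbitPreimage α β (orbit α N w x e) n) =
      (n : ℂ) • (1 + α • N) (prev (orbitPreimage α β (orbit α N w x e)) n) := by
  cases n with
  | zero => simp [orbitPreimage, orbit, prev, he]
  | succ n =>
    simp only [orbitPreimage, prev_succ, map_add, map_sub, map_smul]
    rw [lowering_orbit h he, lowering_orbit h he, lowering_prev_orbit h he, prev_succ]
    push_cast
    module

/-- With B = 1 + αN, the lowering relation turns B² applied to the preimage into (B² − (α+β)BN +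
αβN²)p_n. This factors as (B − αN)(B − βN) = 1 + (α−β)N = u, which w cancels. -/
theorem inv_mul_sq_orbitPreimage (h : IsDifferenceCalculus (α - β) N u w x) {e : V}
    (he : N e = 0) (n : ℕ) :
    w ((1 + α • N) ((1 + α • N) (orbitPreimage α β (orbit α N w x e) n))) =
      orbit α N w x e n := by
  have h1 := lowering_orbit h he n
  have h2 := lowering_prev_orbit h he n
  have hw : ∀ v, w (u v) = v := fun v => by
    have := congrArg (fun f : Module.End ℂ V => f v) h.inv_mul
    simpa using this
  unfold orbitPreimage
  -- Writing p_n as w(u p_n) lets w be stripped from both sides.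
  rw [← hw (orbit α N w x e n)]
  congr 1
  rw [hw, h.shift_eq]
  generalize orbit α N w x e n = p at *
  generalize prev (orbit α N w x e) n = q at *
  generalize prev (prev (orbit α N w x e)) n = r at *
  have hBN : ∀ v, (1 + α • N) (N v) = N ((1 + α • N) v) := fun v => by simp
  have hB : ∀ v, (1 + α • N) v = v + α • N v := fun v => by simp
  have e1 : (n : ℂ) • (1 + α • N) ((1 + α • N) q) = (1 + α • N) (N p) := by
    rw [h1, map_smul]
  have e2 : ((n : ℂ) * (n - 1)) • (1 + α • N) ((1 + α • N) r) = N (N p) := by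
    rw [h1, map_smul, ← hBN, h2, map_smul, smul_smul]
  rw [map_add, map_sub, map_add, map_sub]
  simp only [map_smul, mul_smul (α + β), mul_smul (α * β) ((n : ℂ) * (n - 1)), e1, e2]
  simp only [hB, map_add, map_smul, LinearMap.add_apply, LinearMap.smul_apply,
    Module.End.one_apply]
  module

/-- Evaluate R on the preimage q_n of p_n in two ways. Index shifting gives the terms in p_{n+1},
p_n, p_{n−1}; the definition of R gives x p_n − N w(1+αN)q_n, whose second term is n p_{n−1}. -/
theorem mulX_orbit (h : IsDifferenceCalculus (α - β) N u w x) {e : V} (he : N e = 0) (n : ℕ) :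
    x (orbit α N w x e n) = orbit α N w x e (n + 1) - ((α + β) * n) • orbit α N w x e n
      + (n * (1 + α * β * (n - 1))) • prev (orbit α N w x e) n := by
  have hpre := inv_mul_sq_orbitPreimage h he
  have hwN : ∀ v, w (N v) = N (w v) := fun v =>
    congrArg (fun f : Module.End ℂ V => f v) h.comm
  have hwB : ∀ v, w ((1 + α • N) v) = (1 + α • N) (w v) := fun v => by simp [hwN]
  have hBN : ∀ v, (1 + α • N) (N v) = N ((1 + α • N) v) := fun v => by simp
  have e1 := raising_orbitPreimage (α := α) (β := β) (N := N) (w := w) (x := x) e n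
  have e2 : raising α N w x (orbitPreimage α β (orbit α N w x e) n) =
      x (orbit α N w x e n) -
        N (w ((1 + α • N) (orbitPreimage α β (orbit α N w x e) n))) := by
    have hp : (1 + α • N) ((1 + α • N) (w (orbitPreimage α β (orbit α N w x e) n))) =
        orbit α N w x e n := by
      rw [← hwB, ← hwB, hpre n]
    rw [← hp, hwB, ← hBN]
    simp only [raising, pow_two, LinearMap.sub_apply, Module.End.mul_apply, hp]
  have e3 : N (w ((1 + α • N) (orbitPreimage α β (orbit α N w x e) n))) =
      (n : ℂ) • prev (orbit α N w x e) n := by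
    rw [← hwN, ← hBN, lowering_orbitPreimage h he, map_smul, map_smul]
    cases n with
    | zero => simp
    | succ n => rw [prev, prev, hpre n]
  rw [e2, e3] at e1
  rw [sub_eq_iff_eq_add.mp e1]
  module

end Abstract
/-! ### Coefficient estimates -/

/-- The `n`-th derivative at `0`, as a linear functional. -/
def derivAtZero (n : ℕ) : EminC →ₗ[ℂ] ℂ where
  toFun f := iteratedDeriv n f.1 0
  map_add' f g := iteratedDeriv_add f.2.1.contDiff.contDiffAt g.2.1.contDiff.contDiffAt
  map_smul' c f := iteratedDeriv_const_smul f.2.1.contDiff.contDiffAt c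

theorem sqNorm_eq_tsum (q : ℕ) (f : EminC) :
    sqNorm q f.1 = ∑' n : ℕ, ‖derivAtZero n f‖ ^ 2 * 2 ^ (n * q) := by
  refine tsum_congr fun n => ?_
  rw [← mul_pow, norm_taylorCoeff_mul_factorial]
  rfl

theorem summable_derivAtZero (q : ℕ) (f : EminC) :
    Summable fun n : ℕ => ‖derivAtZero n f‖ ^ 2 * 2 ^ (n * q) := by
  refine (summable_sqNorm q f).congr fun n => ?_
  rw [← mul_pow, norm_taylorCoeff_mul_factorial]
  rfl

theorem norm_derivAtZero_mul_le (r n : ℕ) (f : EminC) :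
    ‖derivAtZero n f‖ * 2 ^ (n * r) ≤ seminormC (2 * r) f := by
  refine Real.le_sqrt_of_sq_le ?_
  rw [sqNorm_eq_tsum]
  refine le_trans (le_of_eq ?_) ((summable_derivAtZero (2 * r) f).le_tsum n
    fun _ _ => by positivity)
  rw [mul_pow, ← pow_mul]
  congr 2
  ring

/-- A weighted supremum bound controls the ℓ² norm: one extra factor 2ⁿ in the weight pays for a
geometric series. -/
theorem seminormC_le (q : ℕ) (f : EminC) {K : ℝ} (hK : 0 ≤ K)
    (h : ∀ n, ‖derivAtZero n f‖ * 2 ^ (n * (q + 1)) ≤ K) : seminormC q f ≤ 2 * K := by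
  have hg : HasSum (fun n : ℕ => K ^ 2 * (1 / 2 : ℝ) ^ n) (K ^ 2 * 2) :=
    hasSum_geometric_two.mul_left _
  refine Real.sqrt_le_iff.mpr ⟨by positivity, ?_⟩
  rw [sqNorm_eq_tsum]
  refine ((summable_derivAtZero q f).tsum_le_tsum (fun n => ?_) hg.summable).trans ?_
  · rw [one_div, inv_pow, ← div_eq_mul_inv, le_div_iff₀ (by positivity)]
    refine le_trans ?_ (pow_le_pow_left₀ (by positivity) (h n) 2)
    rw [mul_pow, mul_assoc, ← pow_mul, ← pow_add]
    gcongr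
    · norm_num
    · nlinarith [Nat.zero_le (n * q)]
  · rw [hg.tsum_eq]; nlinarith

theorem derivAtZero_derivC (n : ℕ) (f : EminC) :
    derivAtZero n (derivC f) = derivAtZero (n + 1) f := by
  change iteratedDeriv n (deriv f.1) 0 = iteratedDeriv (n + 1) f.1 0
  rw [iteratedDeriv_succ']

theorem derivC_mulC : derivC * mulC = mulC * derivC + 1 := by
  refine LinearMap.ext fun f => Subtype.ext (funext fun z => ?_)
  change deriv (fun z => z * f.1 z) z = z * deriv f.1 z + f.1 z
  rw [deriv_fun_mul differentiableAt_fun_id (f.2.1 z)]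
  simp [add_comm]

theorem derivAtZero_mulC (n : ℕ) (f : EminC) :
    derivAtZero n (mulC f) = n * derivAtZero (n - 1) f := by
  induction n generalizing f with
  | zero => simp [derivAtZero, mulC]
  | succ n ih =>
    have h : derivC (mulC f) = mulC (derivC f) + f :=
      congrArg (fun T : Module.End ℂ EminC => T f) derivC_mulC
    rw [← derivAtZero_derivC, h, map_add, ih, derivAtZero_derivC]
    cases n with
    | zero => simp
    | succ n => simp; ring

theorem seminormC_derivC_le (q : ℕ) (f : EminC) :
    seminormC q (derivC f) ≤ 2 * seminormC (2 * (q + 1)) f := by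
  refine seminormC_le q _ (apply_nonneg _ _) fun n => ?_
  rw [derivAtZero_derivC]
  refine le_trans ?_ (norm_derivAtZero_mul_le _ (n + 1) f)
  gcongr
  · norm_num
  · omega

theorem seminormC_mulC_le (q : ℕ) (f : EminC) :
    seminormC q (mulC f) ≤ 2 * (2 ^ (q + 1) * seminormC (2 * (q + 2)) f) := by
  have h0 : 0 ≤ seminormC (2 * (q + 2)) f := apply_nonneg _ _
  refine seminormC_le q _ (by positivity) fun n => ?_
  rw [derivAtZero_mulC]
  cases n with
  | zero => simp [h0]
  | succ n =>
    -- The factor n + 1 from differentiating the product is absorbed by one more power 2ⁿ of the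
    -- weight.
    have h1 : ((n + 1 : ℕ) : ℝ) ≤ 2 ^ n := by exact_mod_cast Nat.lt_two_pow_self
    rw [norm_mul, Complex.norm_natCast, Nat.add_sub_cancel]
    calc ((n + 1 : ℕ) : ℝ) * ‖derivAtZero n f‖ * 2 ^ ((n + 1) * (q + 1))
        ≤ 2 ^ n * ‖derivAtZero n f‖ * 2 ^ ((n + 1) * (q + 1)) := by gcongr
      _ = 2 ^ (q + 1) * (‖derivAtZero n f‖ * 2 ^ (n * (q + 2))) := by ring
      _ ≤ _ := by
        gcongr
        exact norm_derivAtZero_mul_le _ _ _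

/-- This is the Taylor series at 0 of the n-th derivative, evaluated at s. -/
theorem hasSum_derivAtZero_shiftC (s : ℂ) (n : ℕ) (f : EminC) :
    HasSum (fun k : ℕ => (k.factorial : ℂ)⁻¹ * s ^ k * derivAtZero (n + k) f)
      (derivAtZero n (shiftC s f)) := by
  have hd : Differentiable ℂ (iteratedDeriv n f.1) :=
    (f.2.1.contDiff (n := n + 1)).differentiable_iteratedDeriv n (by exact_mod_cast Nat.lt_succ_self n)
  have h := Complex.hasSum_taylorSeries_of_entire hd 0 s
  have e : derivAtZero n (shiftC s f) = iteratedDeriv n f.1 s := by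
    change iteratedDeriv n (fun z => f.1 (z + s)) 0 = _
    rw [iteratedDeriv_comp_add_const]
    simp
  rw [e]
  convert! h using 2 with k
  have : iteratedDeriv k (iteratedDeriv n f.1) = iteratedDeriv (n + k) f.1 := by
    simp only [iteratedDeriv_eq_iterate]
    rw [← Function.iterate_add_apply, add_comm]
  simp [this, derivAtZero, mul_assoc]

theorem seminormC_shiftC_le (s : ℂ) (q : ℕ) (f : EminC) :
    seminormC q (shiftC s f) ≤ 2 * (Real.exp ‖s‖ * seminormC (2 * (q + 1)) f) := by
  have h0 : 0 ≤ seminormC (2 * (q + 1)) f := apply_nonneg _ _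
  refine seminormC_le q _ (by positivity) fun n => ?_
  rw [← (hasSum_derivAtZero_shiftC s n f).tsum_eq, ← le_div_iff₀ (by positivity), mul_div_assoc]
  have he : HasSum (fun k : ℕ => (k.factorial : ℝ)⁻¹ * ‖s‖ ^ k) (Real.exp ‖s‖) := by
    rw [Real.exp_eq_exp_ℝ]
    simpa using NormedSpace.exp_series_hasSum_exp' (𝕂 := ℝ) ‖s‖
  refine tsum_of_norm_bounded (he.mul_right _) fun k => ?_
  rw [norm_mul, norm_mul, norm_inv, norm_pow, Complex.norm_natCast]
  gcongr
  rw [le_div_iff₀ (by positivity)]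
  refine le_trans ?_ (norm_derivAtZero_mul_le _ (n + k) f)
  gcongr
  · norm_num
  · omega

/-! ### Continuity -/

instance : IsTopologicalAddGroup EminR := withSeminorms.topologicalAddGroup

instance : ContinuousSMul ℂ EminR := withSeminorms.continuousSMul

theorem continuous_conj (T : Module.End ℂ EminC)
    (h : ∀ q, ∃ r : ℕ, ∃ C : ℝ, 0 ≤ C ∧ ∀ f, seminormC q (T f) ≤ C * seminormC r f) :
    Continuous (toReal.conj T) := by
  refine withSeminorms.continuous_of_isBounded withSeminorms _ fun q => ?_
  obtain ⟨r, C, hC, hb⟩ := h q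
  refine ⟨{r}, ⟨C, hC⟩, fun f => ?_⟩
  have h1 : seminormR q (toReal.conj T f) ≤ C * seminormR r f := by
    simpa [seminormR, LinearEquiv.conj_apply] using hb (toReal.symm f)
  rw [Finset.sup_singleton]
  exact h1

theorem continuous_mulX : Continuous mulX :=
  continuous_conj _ fun q => ⟨_, 2 * 2 ^ (q + 1), by positivity, fun f => by
    rw [mul_assoc]; exact seminormC_mulC_le q f⟩

theorem continuous_D : Continuous D :=
  continuous_conj _ fun q => ⟨_, 2, by positivity, seminormC_derivC_le q⟩

theorem continuous_U (s : ℂ) : Continuous (U s) :=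
  continuous_conj _ fun q => ⟨_, 2 * Real.exp ‖s‖, by positivity, fun f => by
    rw [mul_assoc]; exact seminormC_shiftC_le s q f⟩

theorem continuous_nabla (s : ℂ) : Continuous (nabla s) :=
  ((continuous_U s).sub continuous_id).const_smul s⁻¹

theorem continuous_raising (α : ℂ) {N w x : Module.End ℂ EminR} (hN : Continuous N)
    (hw : Continuous w) (hx : Continuous x) : Continuous (raising α N w x) := by
  have hB : Continuous (1 + α • N : Module.End ℂ EminR) := continuous_id.add (hN.const_smul α)
  rw [raising, pow_two]
  exact (hx.comp ((hB.comp hB).comp hw)).sub ((hB.comp hN).comp hw)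

/-! ### Density of polynomials -/

theorem eq_zero_of_derivAtZero (f : EminC) (h : ∀ n, derivAtZero n f = 0) : f = 0 := by
  apply Subtype.ext
  funext z
  have := Complex.hasSum_taylorSeries_of_entire f.2.1 0 z
  refine this.unique ?_
  convert! hasSum_zero using 2 with n
  have hn : iteratedDeriv n f.1 0 = 0 := h n
  simp [hn]

/-- The norm of index 0 already dominates every derivative at 0, hence separates points. Uniqueness
by density rests on this. -/
instance : T1Space EminR := withSeminorms.T1_of_separating fun f hf => by
  refine ⟨0, fun h0 => hf ?_⟩
  rw [← toReal.symm.map_eq_zero_iff]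
  refine eq_zero_of_derivAtZero _ fun n => ?_
  have h1 := norm_derivAtZero_mul_le 0 n (toReal.symm f)
  have h2 : seminormC (2 * 0) (toReal.symm f) = 0 := h0
  rw [h2] at h1
  simpa using h1

/-- The constant function `1`. -/
def oneC : EminC := ⟨fun _ => 1, one_mem_EminC⟩

theorem derivAtZero_mulC_pow_oneC (n k : ℕ) :
    derivAtZero n ((mulC ^ k) oneC) = if n = k then (n.factorial : ℂ) else 0 := by
  induction k generalizing n with
  | zero =>
    change iteratedDeriv n (fun _ => (1 : ℂ)) 0 = _
    rcases n with _ | n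
    · simp
    · simp [iteratedDeriv_const]
  | succ k ih =>
    rw [pow_succ', Module.End.mul_apply, derivAtZero_mulC, ih]
    cases n with
    | zero => simp
    | succ n => simp [Nat.factorial_succ]

/-- The Taylor polynomial of degree `< m` at `0`. -/
def taylorPoly (f : EminC) (m : ℕ) : EminC :=
  ∑ k ∈ Finset.range m, taylorCoeff f.1 k • (mulC ^ k) oneC

theorem derivAtZero_taylorPoly (f : EminC) (m n : ℕ) :
    derivAtZero n (taylorPoly f m) = if n < m then derivAtZero n f else 0 := by
  have hn : (n.factorial : ℂ) ≠ 0 := by exact_mod_cast n.factorial_ne_zero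
  simp only [taylorPoly, map_sum, map_smul, derivAtZero_mulC_pow_oneC, smul_eq_mul, mul_ite,
    mul_zero, Finset.sum_ite_eq, Finset.mem_range, taylorCoeff, div_mul_cancel₀ _ hn]
  rfl

theorem seminormC_sub_taylorPoly_le (q m : ℕ) (f : EminC) :
    seminormC q (taylorPoly f m - f) ≤ 2 * ((1 / 2) ^ m * seminormC (2 * (q + 2)) f) := by
  have h0 : 0 ≤ seminormC (2 * (q + 2)) f := apply_nonneg _ _
  refine seminormC_le q _ (by positivity) fun n => ?_
  rw [map_sub, derivAtZero_taylorPoly]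
  split_ifs with hn
  · rw [sub_self, norm_zero, zero_mul]; positivity
  · rw [zero_sub, norm_neg]
    -- In the tail n ≥ m, raising the weight exponent by one frees a factor 2⁻ⁿ ≤ 2⁻ᵐ.
    calc ‖derivAtZero n f‖ * 2 ^ (n * (q + 1))
        = (1 / 2) ^ n * (‖derivAtZero n f‖ * 2 ^ (n * (q + 2))) := by
          rw [show n * (q + 2) = n * (q + 1) + n by ring, pow_add, one_div, inv_pow]
          field_simp
      _ ≤ (1 / 2) ^ m * seminormC (2 * (q + 2)) f := by
          gcongr ?_ * ?_
          · exact pow_le_pow_of_le_one (by norm_num) (by norm_num) (not_lt.mp hn)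
          · exact norm_derivAtZero_mul_le _ _ _

theorem tendsto_toReal_taylorPoly (f : EminC) :
    Filter.Tendsto (fun m => toReal (taylorPoly f m)) Filter.atTop (nhds (toReal f)) := by
  rw [withSeminorms.tendsto_nhds]
  intro q ε hε
  have ht : Filter.Tendsto (fun m : ℕ => 2 * ((1 / 2 : ℝ) ^ m * seminormC (2 * (q + 2)) f))
      Filter.atTop (nhds (2 * (0 * seminormC (2 * (q + 2)) f))) :=
    ((tendsto_pow_atTop_nhds_zero_of_lt_one (by norm_num) (by norm_num)).mul_const _).const_mul _
  rw [zero_mul, mul_zero] at ht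
  filter_upwards [ht.eventually_lt_const hε] with m hm
  refine lt_of_le_of_lt ?_ hm
  have := seminormC_sub_taylorPoly_le q m f
  simpa [seminormR, ← map_sub] using this

/-- Such a subspace contains all monomials, hence all Taylor polynomials, which converge in every
norm. -/
theorem dense_of_mulX_mem (S : Submodule ℂ EminR) (h1 : toReal oneC ∈ S)
    (hx : ∀ f ∈ S, mulX f ∈ S) : Dense (S : Set EminR) := by
  have hpow : ∀ k, toReal ((mulC ^ k) oneC) ∈ S := fun k => by
    induction k with
    | zero => simpa using h1
    | succ k ih =>
      have := hx _ ih
      rw [pow_succ']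
      simpa [mulX, LinearEquiv.conj_apply] using this
  intro f
  have := tendsto_toReal_taylorPoly (toReal.symm f)
  rw [LinearEquiv.apply_symm_apply] at this
  refine mem_closure_of_tendsto this (Filter.Eventually.of_forall fun m => ?_)
  simp only [taylorPoly, map_sum, map_smul, SetLike.mem_coe]
  exact S.sum_mem fun k _ => S.smul_mem _ (hpow k)

/-! ### The Meixner polynomials -/

theorem ofPoly_one : ofPoly 1 = toReal oneC :=
  congrArg toReal (Subtype.ext (funext fun z => by simp [oneC]))

theorem ofPoly_meixner_succ (lam eta : ℝ) (n : ℕ) :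
    ofPoly (meixner lam eta (n + 1)) = mulX (ofPoly (meixner lam eta n))
      - ((lam : ℂ) * n) • ofPoly (meixner lam eta n)
      - (n * (1 + (eta : ℂ) * (n - 1))) • prev (fun k => ofPoly (meixner lam eta k)) n := by
  apply Subtype.ext
  funext x
  change ofPoly (meixner lam eta (n + 1)) x = mulX (ofPoly (meixner lam eta n)) x
    - ((lam : ℂ) * n) * ofPoly (meixner lam eta n) x
    - (n * (1 + (eta : ℂ) * (n - 1))) * (prev (fun k => ofPoly (meixner lam eta k)) n) x
  rw [mulX_apply]
  cases n with
  | zero => simp [ofPoly_apply, meixner]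
  | succ n =>
    simp only [prev_succ, ofPoly_apply, meixner, Polynomial.eval_sub, Polynomial.eval_mul,
      Polynomial.eval_X, Polynomial.eval_C]
    push_cast
    ring

theorem dense_span_meixner (lam eta : ℝ) :
    Dense (Submodule.span ℂ (Set.range fun n => ofPoly (meixner lam eta n)) : Set EminR) := by
  have hmem : ∀ n, ofPoly (meixner lam eta n) ∈
      Submodule.span ℂ (Set.range fun n => ofPoly (meixner lam eta n)) :=
    fun n => Submodule.subset_span ⟨n, rfl⟩
  refine dense_of_mulX_mem _ ?_ fun f hf => ?_
  · rw [← ofPoly_one]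
    exact hmem 0
  · induction hf using Submodule.span_induction with
    | mem f hf =>
      obtain ⟨n, rfl⟩ := hf
      have h := ofPoly_meixner_succ lam eta n
      -- Solved for x P_n, the recurrence shows that multiplication by x preserves the span.
      rw [sub_sub, eq_sub_iff_add_eq] at h
      simp only [← h]
      refine Submodule.add_mem _ (hmem _) (Submodule.add_mem _ (Submodule.smul_mem _ _ (hmem n))
        (Submodule.smul_mem _ _ ?_))
      cases n with
      | zero => exact Submodule.zero_mem _
      | succ n => exact hmem n
    | zero => rw [map_zero]; exact Submodule.zero_mem _
    | add f g _ _ hf hg => rw [map_add]; exact Submodule.add_mem _ hf hg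
    | smul c f _ hf => rw [map_smul]; exact Submodule.smul_mem _ _ hf

theorem existsUnique_isRaisingOperator {lam eta : ℝ} {T : Module.End ℂ EminR} (hT : Continuous T)
    (h : ∀ n, T (ofPoly (meixner lam eta n)) = ofPoly (meixner lam eta (n + 1))) :
    (∃! T : EminR →L[ℂ] EminR, IsRaisingOperator lam eta T) ∧
      ∀ T' : EminR →L[ℂ] EminR, IsRaisingOperator lam eta T' → (T' : Module.End ℂ EminR) = T := by
  have huniq : ∀ T' : EminR →L[ℂ] EminR, IsRaisingOperator lam eta T' → T' = ⟨T, hT⟩ :=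
    fun T' hT' => ContinuousLinearMap.ext_on (dense_span_meixner lam eta) (by
      rintro _ ⟨n, rfl⟩
      exact (hT' n).trans (h n).symm)
  exact ⟨⟨⟨T, hT⟩, h, huniq⟩, fun T' hT' => by rw [huniq T' hT']⟩

/-! ### Derivative and difference operators as difference calculi -/

theorem isDifferenceCalculus_D : IsDifferenceCalculus 0 D 1 1 mulX where
  shift_eq := by simp
  comm := by simp
  inv_mul := by simp
  leibniz := by
    have h := congrArg (LinearEquiv.conjAlgEquiv ℂ toReal) derivC_mulC
    rw [map_add, map_mul, map_mul, map_one] at h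
    exact h

theorem U_zero : U 0 = 1 := by
  refine LinearMap.ext fun f => Subtype.ext (funext fun x => ?_)
  rw [U_apply, add_zero, symm_apply_ofReal]
  rfl

theorem U_mul_U (s t : ℂ) : U s * U t = U (s + t) := by
  have h : shiftC s * shiftC t = shiftC (s + t) := by
    refine LinearMap.ext fun f => Subtype.ext (funext fun z => ?_)
    change f.1 (z + s + t) = f.1 (z + (s + t))
    rw [add_assoc]
  have h' := congrArg (LinearEquiv.conjAlgEquiv ℂ toReal) h
  rw [map_mul] at h'
  exact h'

theorem U_mul_mulX (s : ℂ) : U s * mulX = mulX * U s + s • U s := by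
  have h : shiftC s * mulC = mulC * shiftC s + s • shiftC s := by
    refine LinearMap.ext fun f => Subtype.ext (funext fun z => ?_)
    change (z + s) * f.1 (z + s) = z * f.1 (z + s) + s * f.1 (z + s)
    ring
  have h' := congrArg (LinearEquiv.conjAlgEquiv ℂ toReal) h
  rw [map_add, map_mul, map_mul, map_smul] at h'
  exact h'

theorem isDifferenceCalculus_nabla {s : ℂ} (hs : s ≠ 0) :
    IsDifferenceCalculus s (nabla s) (U s) (U (-s)) mulX where
  shift_eq := by rw [nabla, smul_inv_smul₀ hs, add_sub_cancel]
  comm := by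
    rw [nabla, mul_smul_comm, smul_mul_assoc, mul_sub, sub_mul, U_mul_U, U_mul_U, add_comm,
      mul_one, one_mul]
  inv_mul := by rw [U_mul_U, neg_add_cancel, U_zero]
  leibniz := by
    rw [nabla, mul_smul_comm, smul_mul_assoc, mul_sub, sub_mul, U_mul_mulX, mul_one, one_mul,
      add_sub_right_comm, smul_add, inv_smul_smul₀ hs]

theorem D_one : D (toReal oneC) = 0 := by
  have h : derivC oneC = 0 := Subtype.ext (funext fun z => deriv_const z (1 : ℂ))
  rw [D, LinearEquiv.conj_apply_apply, LinearEquiv.symm_apply_apply, h, map_zero]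

theorem nabla_one (s : ℂ) : nabla s (toReal oneC) = 0 := by
  have h : U s (toReal oneC) = toReal oneC := by
    rw [U, LinearEquiv.conj_apply_apply, LinearEquiv.symm_apply_apply]
    rfl
  simp [nabla, h]

/-! ### The raising operator -/

section

variable {lam eta : ℝ} {α β : ℂ} {N u w : Module.End ℂ EminR}

theorem orbit_eq_ofPoly_meixner (h : IsDifferenceCalculus (α - β) N u w mulX)
    (hN : N (toReal oneC) = 0) (hadd : α + β = -lam) (hmul : α * β = eta) (n : ℕ) :
    orbit α N w mulX (toReal oneC) n = ofPoly (meixner lam eta n) := by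
  induction n using Nat.strong_induction_on with
  | _ n ih =>
    cases n with
    | zero => exact ofPoly_one.symm
    | succ n =>
      have h1 := mulX_orbit h hN n
      have h2 : prev (orbit α N w mulX (toReal oneC)) n =
          prev (fun k => ofPoly (meixner lam eta k)) n := by
        cases n with
        | zero => rfl
        | succ n => exact ih n (by omega)
      rw [ofPoly_meixner_succ, ← ih n (by omega), ← h2, h1, hmul, hadd]
      module

theorem raising_spec (h : IsDifferenceCalculus (α - β) N u w mulX)
    (hN : N (toReal oneC) = 0) (hNc : Continuous N) (hwc : Continuous w)
    (hadd : α + β = -lam) (hmul : α * β = eta) :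
    (∃! T : EminR →L[ℂ] EminR, IsRaisingOperator lam eta T) ∧
      ∀ T : EminR →L[ℂ] EminR, IsRaisingOperator lam eta T →
        (T : Module.End ℂ EminR) = raising α N w mulX := by
  refine existsUnique_isRaisingOperator (continuous_raising α hNc hwc continuous_mulX) fun n => ?_
  rw [← orbit_eq_ofPoly_meixner h hN hadd hmul, ← orbit_eq_ofPoly_meixner h hN hadd hmul,
    orbit_succ]

theorem raising_D_spec (hadd : α + α = -lam) (hmul : α * α = eta) :
    (∃! T : EminR →L[ℂ] EminR, IsRaisingOperator lam eta T) ∧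
      ∀ T : EminR →L[ℂ] EminR, IsRaisingOperator lam eta T →
        (T : Module.End ℂ EminR) = mulX * (1 + α • D) ^ 2 - (1 + α • D) * D := by
  have h : IsDifferenceCalculus (α - α) D 1 1 mulX := by
    rw [sub_self]; exact isDifferenceCalculus_D
  simpa [raising] using raising_spec h D_one continuous_D continuous_id hadd hmul

theorem raising_nabla_spec (hne : α ≠ β) (hadd : α + β = -lam) (hmul : α * β = eta) :
    (∃! T : EminR →L[ℂ] EminR, IsRaisingOperator lam eta T) ∧
      ∀ T : EminR →L[ℂ] EminR, IsRaisingOperator lam eta T →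
        (T : Module.End ℂ EminR) = mulX * (1 + α • nabla (α - β)) ^ 2 * U (β - α)
          - (1 + α • nabla (α - β)) * nabla (α - β) * U (β - α) := by
  have h := isDifferenceCalculus_nabla (sub_ne_zero.mpr hne)
  rw [neg_sub] at h
  exact raising_spec h (nabla_one _) (continuous_nabla _) (continuous_U _) hadd hmul

theorem ne_of_sq_ne_four_mul (hne : lam ^ 2 ≠ 4 * eta) (hadd : α + β = -lam)
    (hmul : α * β = eta) : α ≠ β := by
  rintro rfl
  apply hne
  have : ((lam ^ 2 : ℝ) : ℂ) = ((4 * eta : ℝ) : ℂ) := by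
    push_cast
    rw [← hmul, ← neg_sq, ← hadd]
    ring
  exact_mod_cast this

theorem existsUnique_raisingOperator (lam eta : ℝ) :
    ∃! T : EminR →L[ℂ] EminR, IsRaisingOperator lam eta T := by
  by_cases hne : lam ^ 2 = 4 * eta
  · refine (raising_D_spec (α := -(lam / 2 : ℝ)) ?_ ?_).1
    · push_cast; ring
    · have : eta = (lam / 2) ^ 2 := by linarith
      rw [this]; push_cast; ring
  -- r is a square root of the discriminant of t² + λt + η, whose roots (−λ ± r)/2 may be non-real.
  · obtain ⟨r, hr⟩ := IsAlgClosed.exists_pow_nat_eq ((lam : ℂ) ^ 2 - 4 * eta) two_pos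
    have hadd : (-lam + r) / 2 + (-lam - r) / 2 = (-lam : ℂ) := by ring
    have hmul : (-lam + r) / 2 * ((-lam - r) / 2) = (eta : ℂ) := by
      linear_combination -hr / 4
    exact (raising_nabla_spec (ne_of_sq_ne_four_mul hne hadd hmul) hadd hmul).1

end

end

end ClassicalMeixner

/-! ### The four cases -/

open ClassicalMeixner in
theorem corollary4 (lam eta : ℝ) (heta : 0 ≤ eta) :
    (∃! T : EminR →L[ℂ] EminR, IsRaisingOperator lam eta T) ∧
    ∀ T : EminR →L[ℂ] EminR, IsRaisingOperator lam eta T →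
      (lam = 0 → eta = 0 →
        (T : Module.End ℂ EminR) = mulX - D) ∧
      (lam ≠ 0 → eta = 0 →
        (T : Module.End ℂ EminR) =
          mulX * (1 - (lam : ℂ) • nabla (-lam)) - nabla (-lam)) ∧
      (0 < eta → lam ^ 2 = 4 * eta →
        (T : Module.End ℂ EminR) =
          mulX * (1 - ((lam / 2 : ℝ) : ℂ) • D) ^ 2 - D * (1 - ((lam / 2 : ℝ) : ℂ) • D)) ∧
      (0 < eta → lam ^ 2 ≠ 4 * eta →
        ∀ α β : ℂ, α + β = -lam → α * β = eta →
          (T : Module.End ℂ EminR) =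
            mulX * (1 + α • nabla (α - β)) ^ 2 * U (β - α)
              - (1 + α • nabla (α - β)) * nabla (α - β) * U (β - α)) := by
  refine ⟨existsUnique_raisingOperator lam eta, fun T hT => ⟨?_, ?_, ?_, ?_⟩⟩
  · rintro rfl rfl
    simpa using (raising_D_spec (α := 0) (by simp) (by simp)).2 T hT
  · rintro hlam rfl
    have hlam' : (lam : ℂ) ≠ 0 := by exact_mod_cast hlam
    -- With α = 0 the formula reads x U_{−λ} − ∇_λ U_{−λ}. It simplifies by U_{−λ} = 1 − λ∇_{−λ} and
    -- ∇_λ U_{−λ} = ∇_{−λ}.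
    have h := (raising_nabla_spec (α := 0) (β := -lam) (by simpa using hlam) (by simp)
      (by simp)).2 T hT
    rw [h]
    simp only [nabla, zero_smul, add_zero, one_pow, mul_one, one_mul, zero_sub, sub_zero, neg_neg,
      smul_mul_assoc, sub_mul, U_mul_U, add_neg_cancel, U_zero, inv_neg, neg_smul, smul_neg,
      smul_inv_smul₀ hlam', smul_sub]
    simp [neg_add_eq_sub]
  · intro _ hsq
    -- The double root α = β = −λ/2 makes the step zero, so differentiation replaces the difference
    -- operator.
    have h := (raising_D_spec (lam := lam) (eta := eta) (α := -(lam / 2 : ℝ))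
      (by push_cast; ring) ?_).2 T hT
    · rw [h, neg_smul, ← sub_eq_add_neg, mul_sub, sub_mul, mul_one, one_mul, smul_mul_assoc,
        mul_smul_comm]
    · have : eta = (lam / 2) ^ 2 := by linarith
      rw [this]; push_cast; ring
  · intro _ hne α β hadd hmul
    exact (raising_nabla_spec (ne_of_sq_ne_four_mul hne hadd hmul) hadd hmul).2 T hT
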